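/- Let $\varphi:\mathbb{R}^n\to(-\infty,\infty]$ be lower semicontinuous and prox-bounded, let $\bar x\in\operatorname{dom}\varphi:=\{x\mid\varphi(x)<\infty\}$, and let $\bar v\in\partial\varphi(\bar x)$. Then the following assertions are equivalent: (i) $\varphi$ is variationally strongly convex at $\bar x$ for $\bar v$ with some modulus $\sigma>0$. (ii) $\varphi$ is prox-regular at $\bar x$ for $\bar v$, and there is $\lambda_0>0$ such that for every $\lambda\in(0,\lambda_0)$ the Moreau envelope $e_\lambda\varphi$ is locally strongly convex around $\bar x+\lambda\bar v$, i.e. strongly convex on some convex neighborhood of $\bar x+\lambda\bar v$ with some modulus $\kappa_\lambda>0$ (neighborhood and modulus may depend on $\lambda$). Here the following notions are used. The regular subdifferential $\widehat\partial\varphi(x)$ at $x\in\operatorname{dom}\varphi$ is the set of all $v$ with $\liminf_{y\to x,\,y\ne x}\frac{\varphi(y)-\varphi(x)-\langle v,y-x\rangle}{\|y-x\|}\ge 0$. The limiting subdifferential $\partial\varphi(x)$ at $x\in\operatorname{dom}\varphi$ is the set of all $v$ for which there are $x_k\to x$ with $\varphi(x_k)\to\varphi(x)$ and $v_k\in\widehat\partial\varphi(x_k)$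 with $v_k\to v$. Both sets are empty for $x\notin\operatorname{dom}\varphi$, and $\operatorname{gph}\partial\varphi:=\{(x,v)\mid v\in\partial\varphi(x)\}$. The Moreau envelope is $e_\lambda\varphi(x):=\inf_{y\in\mathbb{R}^n}\{\varphi(y)+\frac{1}{2\lambda}\|y-x\|^2\}$ for $\lambda>0$, and $\varphi$ is prox-bounded if $e_\lambda\varphi(x)>-\infty$ for some $\lambda>0$ and some $x$. A function $f$ is strongly convex on a convex set $\Omega$ with modulus $\kappa>0$ if $f((1-t)x+ty)\le(1-t)f(x)+tf(y)-\frac{\kappa}{2}t(1-t)\|x-y\|^2$ for all $x,y\in\Omega$ and $t\in[0,1]$. $\varphi$ is prox-regular at $\bar x$ for $\bar v$ if there are $\varepsilon>0$ and $r\ge0$ such that $\varphi(x)\ge\varphi(u)+\langle v,x-u\rangle-\frac r2\|x-u\|^2$ for all $x$ with $\|x-\bar x\|\le\varepsilon$ and all $(u,v)\in\operatorname{gph}\partial\varphi$ with $\|u-\bar x\|\le\varepsilon$, $\|v-\bar v\|\le\varepsilon$ and $\varphi(u)<\varphi(\bar x)+\varepsilon$. $\varphi$ is variationally strongly convex at $\bar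 x$ for $\bar v$ with modulus $\sigma>0$ if there are convex neighborhoods $U$ of $\bar x$ and $V$ of $\bar v$, a lower semicontinuous function $\psi:\mathbb{R}^n\to(-\infty,\infty]$ that is strongly convex on $U$ with modulus $\sigma$ and satisfies $\psi\le\varphi$ on $U$, and a number $\varepsilon>0$ such that $(U_\varepsilon\times V)\cap\operatorname{gph}\partial\varphi=(U\times V)\cap\operatorname{gph}\partial\psi$, where $U_\varepsilon:=\{x\in U\mid\varphi(x)<\varphi(\bar x)+\varepsilon\}$, and $\varphi(x)=\psi(x)$ whenever $(x,v)$ belongs to this common set. -/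

import Mathlib

open Filter Topology

namespace VarConv

/-- The Euclidean space of dimension n. -/
abbrev Rn (n : ℕ) : Type := EuclideanSpace ℝ (Fin n)

noncomputable section

/-- The (Fréchet) regular subdifferential of an extended-real-valued function at `x`;
it is empty when `x` lies outside the effective domain. -/
def regularSubdiff {n : ℕ} (φ : Rn n → EReal) (x : Rn n) : Set (Rn n) :=
  {v | φ x < ⊤ ∧
    0 ≤ liminf
      (fun y : Rn n => (φ y - φ x - ((inner ℝ v (y - x) : ℝ) : EReal)) / ((‖y - x‖ : ℝ) : EReal))
      (𝓝[≠] x)}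

/-- The (Mordukhovich) limiting subdifferential: limits of regular subgradients at points
`u k` that converge to `x` together with the function values. It is empty when `x` lies
outside the effective domain. -/
def limitingSubdiff {n : ℕ} (φ : Rn n → EReal) (x : Rn n) : Set (Rn n) :=
  {v | φ x < ⊤ ∧ ∃ (u w : ℕ → Rn n),
    Tendsto u atTop (𝓝 x) ∧ Tendsto (fun k => φ (u k)) atTop (𝓝 (φ x)) ∧
    Tendsto w atTop (𝓝 v) ∧ ∀ k, w k ∈ regularSubdiff φ (u k)}

/-- The graph of the limiting subdifferential. -/
def gphSubdiff {n : ℕ} (φ : Rn n → EReal) : Set (Rn n × Rn n) :=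
  {p | p.2 ∈ limitingSubdiff φ p.1}

/-- The Moreau envelope with parameter `lam`. -/
def moreauEnvelope {n : ℕ} (lam : ℝ) (φ : Rn n → EReal) (x : Rn n) : EReal :=
  ⨅ y : Rn n, φ y + ((1 / (2 * lam) * ‖y - x‖ ^ 2 : ℝ) : EReal)

/-- Prox-boundedness. -/
def ProxBounded {n : ℕ} (φ : Rn n → EReal) : Prop :=
  ∃ lam : ℝ, 0 < lam ∧ ∃ x : Rn n, ⊥ < moreauEnvelope lam φ x

/-- Prox-regularity at `xbar` for `vbar`. -/
def ProxRegular {n : ℕ} (φ : Rn n → EReal) (xbar vbar : Rn n) : Prop :=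
  ∃ ε : ℝ, 0 < ε ∧ ∃ r : ℝ, 0 ≤ r ∧
    ∀ x ∈ Metric.closedBall xbar ε,
    ∀ u ∈ Metric.closedBall xbar ε, ∀ v ∈ Metric.closedBall vbar ε,
      (u, v) ∈ gphSubdiff φ → φ u < φ xbar + (ε : EReal) →
      φ u + ((inner ℝ v (x - u) - r / 2 * ‖x - u‖ ^ 2 : ℝ) : EReal) ≤ φ x

/-- Strong convexity with modulus `κ` on a convex set `Ω` of an extended-real-valued function
(in `EReal`, zero times infinity is zero). -/
def StronglyConvexOn {n : ℕ} (Ω : Set (Rn n)) (κ : ℝ) (f : Rn n → EReal) : Prop :=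
  Convex ℝ Ω ∧ ∀ x ∈ Ω, ∀ y ∈ Ω, ∀ t : ℝ, 0 ≤ t → t ≤ 1 →
    f ((1 - t) • x + t • y) ≤
      ((1 - t : ℝ) : EReal) * f x + (t : EReal) * f y
        - ((κ / 2 * t * (1 - t) * ‖x - y‖ ^ 2 : ℝ) : EReal)

/-- Local strong convexity around a point, with some positive modulus. -/
def LocallyStronglyConvexAround {n : ℕ} (f : Rn n → EReal) (z : Rn n) : Prop :=
  ∃ W ∈ 𝓝 z, ∃ κ : ℝ, 0 < κ ∧ StronglyConvexOn W κ f

/-- Variational strong convexity at `xbar` for `vbar` with modulus `σ`. -/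
def VariationallyStronglyConvexWith {n : ℕ} (φ : Rn n → EReal) (xbar vbar : Rn n) (σ : ℝ) :
    Prop :=
  ∃ U ∈ 𝓝 xbar, ∃ V ∈ 𝓝 vbar, Convex ℝ U ∧ Convex ℝ V ∧
    ∃ ψ : Rn n → EReal, (∀ x, ψ x ≠ ⊥) ∧ LowerSemicontinuous ψ ∧ StronglyConvexOn U σ ψ ∧
      (∀ x ∈ U, ψ x ≤ φ x) ∧
      ∃ ε : ℝ, 0 < ε ∧
        ({x ∈ U | φ x < φ xbar + (ε : EReal)} ×ˢ V) ∩ gphSubdiff φ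
            = (U ×ˢ V) ∩ gphSubdiff ψ ∧
        ∀ p ∈ (U ×ˢ V) ∩ gphSubdiff ψ, φ p.1 = ψ p.1

/-- Variational strong convexity at `xbar` for `vbar`, with some positive modulus. -/
def VariationallyStronglyConvex {n : ℕ} (φ : Rn n → EReal) (xbar vbar : Rn n) : Prop :=
  ∃ σ : ℝ, 0 < σ ∧ VariationallyStronglyConvexWith φ xbar vbar σ

end

end VarConv

namespace VarConv

variable {n : ℕ}

/-! Put `μ = 1 / lam`. A subgradient `v` at `y` whose minorant of curvature `-μ` is global makes `y`
a proximal point of `y + lam • v`. Prox-boundedness turns the local inequality of prox-regularity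
into a global one of some curvature `-R`. For `μ > R`, proximal points then exist for every base
point, and they stay close to `xbar` (with their slopes and values) when the base point is close to
`xbar + lam • vbar`.

From variational strong convexity, prox-regularity is immediate because `ψ ≤ φ` with equality at the
relevant subgradients. Near the reference base point the envelope of `φ` is the infimal convolution
over `U` of the `σ`-strongly convex `ψ` with a quadratic of modulus `μ`. Hence it is strongly convex
with modulus `σ * μ / (σ + μ)`.

Conversely, one `lam` with `R < μ` is enough. At `y + lam • v` the envelope has a quadratic majorant
of slope `v`, so its strong convexity forces quadratic growth there. Comparing with `x + lam • v`
gives `φ x` above the quadratic of slope `v` and curvature `κ` at `y`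
(`IsProxPair.le_of_stronglyConvexOn_moreauEnvelope`). The model `ψ` is the supremum of these
quadratics. It has no extra subgradients near the reference pair: one at `x` is compared with the
proximal pair having the same base point, and strong monotonicity makes the two coincide. -/

lemma exists_real_of_ne_bot_of_lt_top {a : EReal} (hb : a ≠ ⊥) (ht : a < ⊤) :
    ∃ r : ℝ, a = r :=
  ⟨a.toReal, (EReal.coe_toReal ht.ne hb).symm⟩

/-! ### Regular and limiting subgradients -/

lemma mem_regularSubdiff_of_le {φ : Rn n → EReal} {x v : Rn n} (hb : φ x ≠ ⊥) (ht : φ x < ⊤)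
    (C : ℝ)
    (h : ∀ y, φ x + ((inner ℝ v (y - x) - C * ‖y - x‖ ^ 2 : ℝ) : EReal) ≤ φ y) :
    v ∈ regularSubdiff φ x := by
  refine ⟨ht, ?_⟩
  obtain ⟨a, ha⟩ := exists_real_of_ne_bot_of_lt_top hb ht
  have hlim : Tendsto (fun y : Rn n => ((-C * ‖y - x‖ : ℝ) : EReal)) (𝓝[≠] x) (𝓝 (0 : EReal)) := by
    have h1 : Tendsto (fun y : Rn n => -C * ‖y - x‖) (𝓝 x) (𝓝 (-C * ‖x - x‖)) :=
      Continuous.tendsto (by fun_prop) x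
    rw [sub_self, norm_zero, mul_zero] at h1
    exact EReal.tendsto_coe.2 (h1.mono_left nhdsWithin_le_nhds)
  refine le_of_forall_lt_imp_le_of_dense fun c hc => ?_
  refine le_liminf_of_le (by isBoundedDefault) ?_
  filter_upwards [hlim.eventually (lt_mem_nhds hc), self_mem_nhdsWithin] with y hy hne
  refine hy.le.trans ?_
  have hs : 0 < ‖y - x‖ := norm_pos_iff.2 (sub_ne_zero.2 hne)
  rw [EReal.le_div_iff_mul_le (by exact_mod_cast hs) (EReal.coe_ne_top _), ha]
  have hy' := h y
  rw [ha] at hy'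
  induction hz : φ y with
  | bot =>
    rw [hz, le_bot_iff, ← EReal.coe_add] at hy'
    exact absurd hy' (EReal.coe_ne_bot _)
  | top => simp
  | coe b =>
    rw [hz] at hy'
    norm_cast at hy' ⊢
    nlinarith

lemma regularSubdiff_subset_limitingSubdiff {φ : Rn n → EReal} {x : Rn n} :
    regularSubdiff φ x ⊆ limitingSubdiff φ x := fun v hv =>
  ⟨hv.1, fun _ => x, fun _ => v, tendsto_const_nhds, tendsto_const_nhds, tendsto_const_nhds,
    fun _ => hv⟩

lemma eventually_le_of_mem_regularSubdiff {φ : Rn n → EReal} {x v : Rn n} {a : ℝ}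
    (ha : φ x = a) (hv : v ∈ regularSubdiff φ x) {η : ℝ} (hη : 0 < η) :
    ∀ᶠ y in 𝓝 x, ((a + inner ℝ v (y - x) - η * ‖y - x‖ : ℝ) : EReal) ≤ φ y := by
  have hlt : ((-η : ℝ) : EReal) < liminf
      (fun y : Rn n => (φ y - φ x - ((inner ℝ v (y - x) : ℝ) : EReal)) / ((‖y - x‖ : ℝ) : EReal))
      (𝓝[≠] x) := lt_of_lt_of_le (by exact_mod_cast neg_lt_zero.2 hη) hv.2
  have h1 := eventually_lt_of_lt_liminf hlt
  rw [eventually_nhdsWithin_iff] at h1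
  filter_upwards [h1] with y hy
  by_cases hne : y = x
  · subst hne
    simp [ha]
  have hy := (hy hne).le
  have hs : 0 < ‖y - x‖ := norm_pos_iff.2 (sub_ne_zero.2 hne)
  rw [EReal.le_div_iff_mul_le (by exact_mod_cast hs) (EReal.coe_ne_top _), ha] at hy
  induction hz : φ y with
  | bot =>
    rw [hz, EReal.bot_sub, EReal.bot_sub, le_bot_iff, ← EReal.coe_mul] at hy
    exact absurd hy (EReal.coe_ne_bot _)
  | top => simp
  | coe b =>
    rw [hz] at hy
    norm_cast at hy ⊢
    linarith

/-- Divide by `t` and let `t` decrease to zero; the term in `K` disappears. This ends both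
first-order arguments along segments. -/
lemma le_of_forall_small_mul {A B K : ℝ}
    (h : ∀ᶠ t in 𝓝[>] (0 : ℝ), A * t ≤ B * t + K * t ^ 2) : A ≤ B := by
  have hl : Tendsto (fun t : ℝ => B + K * t) (𝓝[>] 0) (𝓝 B) := by
    have : Tendsto (fun t : ℝ => B + K * t) (𝓝 0) (𝓝 (B + K * 0)) :=
      Continuous.tendsto (by fun_prop) 0
    rw [mul_zero, add_zero] at this
    exact this.mono_left nhdsWithin_le_nhds
  refine ge_of_tendsto hl ?_
  filter_upwards [h, self_mem_nhdsWithin] with t ht h0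
  have h0 : 0 < t := h0
  nlinarith

lemma tendsto_add_smul_zero (u d : Rn n) :
    Tendsto (fun t : ℝ => u + t • d) (𝓝[>] 0) (𝓝 u) := by
  have : Tendsto (fun t : ℝ => u + t • d) (𝓝 0) (𝓝 (u + (0 : ℝ) • d)) :=
    Continuous.tendsto (by fun_prop) 0
  rw [zero_smul, add_zero] at this
  exact this.mono_left nhdsWithin_le_nhds

/-- A strongly convex function lies above its quadratic model at a regular subgradient. -/
lemma StronglyConvexOn.le_of_mem_regularSubdiff {ψ : Rn n → EReal} {U : Set (Rn n)} {σ : ℝ}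
    (hψ : StronglyConvexOn U σ ψ) (hbot : ∀ x, ψ x ≠ ⊥) {u v x : Rn n} (hu : u ∈ U)
    (hx : x ∈ U) (hv : v ∈ regularSubdiff ψ u) :
    ψ u + ((inner ℝ v (x - u) + σ / 2 * ‖x - u‖ ^ 2 : ℝ) : EReal) ≤ ψ x := by
  obtain ⟨a, ha⟩ := exists_real_of_ne_bot_of_lt_top (hbot u) hv.1
  rcases eq_or_ne (ψ x) ⊤ with htop | htop
  · rw [htop]; exact le_top
  obtain ⟨b, hb⟩ := exists_real_of_ne_bot_of_lt_top (hbot x) (lt_top_iff_ne_top.2 htop)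
  rw [ha, hb, ← EReal.coe_add, EReal.coe_le_coe_iff]
  refine le_of_forall_pos_le_add fun δ hδ => ?_
  -- The `1` in the denominator of the witness covers `x = u`.
  obtain ⟨η, hη, hηδ⟩ : ∃ η : ℝ, 0 < η ∧ η * ‖x - u‖ ≤ δ := by
    refine ⟨δ / (‖x - u‖ + 1), by positivity, ?_⟩
    rw [div_mul_eq_mul_div, div_le_iff₀ (by positivity)]
    nlinarith [norm_nonneg (x - u)]
  refine le_trans ?_ (add_le_add_right hηδ b)
  refine le_of_forall_small_mul (K := σ / 2 * ‖x - u‖ ^ 2) ?_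
  filter_upwards [(tendsto_add_smul_zero u (x - u)).eventually
    (eventually_le_of_mem_regularSubdiff ha hv hη), self_mem_nhdsWithin,
    Ioo_mem_nhdsGT (zero_lt_one' ℝ)] with t ht h0 h1
  have h0 : 0 < t := h0
  have hc := hψ.2 u hu x hx t h0.le h1.2.le
  have he : (1 - t) • u + t • x = u + t • (x - u) := by module
  rw [he, ha, hb] at hc
  have := ht.trans hc
  norm_cast at this
  rw [add_sub_cancel_left, inner_smul_right, norm_smul, Real.norm_eq_abs, abs_of_pos h0,
    norm_sub_rev u x] at this
  nlinarith

/-- A strongly convex function lies above its quadratic model at a limiting subgradient. -/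
lemma StronglyConvexOn.le_of_mem_limitingSubdiff {ψ : Rn n → EReal} {U : Set (Rn n)} {σ : ℝ}
    (hψ : StronglyConvexOn U σ ψ) (hbot : ∀ x, ψ x ≠ ⊥) {u v x : Rn n} (hu : u ∈ interior U)
    (hx : x ∈ U) (hv : v ∈ limitingSubdiff ψ u) :
    ψ u + ((inner ℝ v (x - u) + σ / 2 * ‖x - u‖ ^ 2 : ℝ) : EReal) ≤ ψ x := by
  obtain ⟨hlt, p, w, hp, hψp, hw, hreg⟩ := hv
  obtain ⟨a, ha⟩ := exists_real_of_ne_bot_of_lt_top (hbot u) hlt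
  have hq : Tendsto (fun k => inner ℝ (w k) (x - p k) + σ / 2 * ‖x - p k‖ ^ 2) atTop
      (𝓝 (inner ℝ v (x - u) + σ / 2 * ‖x - u‖ ^ 2)) := by
    have h1 : Tendsto (fun k => x - p k) atTop (𝓝 (x - u)) := tendsto_const_nhds.sub hp
    exact (hw.inner h1).add (((h1.norm).pow 2).const_mul _)
  refine le_of_tendsto ((EReal.continuousAt_add (p := (ψ u, _)) (Or.inr (EReal.coe_ne_bot _))
    (Or.inr (EReal.coe_ne_top _))).tendsto.comp (hψp.prodMk_nhds (EReal.tendsto_coe.2 hq))) ?_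
  filter_upwards [hp.eventually (isOpen_interior.mem_nhds hu)] with k hk
  exact hψ.le_of_mem_regularSubdiff hbot (interior_subset hk) hx (hreg k)

/-! ### Proximal pairs and global quadratic minorants -/

/-- `v` is a subgradient of `φ` at `y` whose quadratic minorant of curvature `-μ` is global. For
`μ = 1 / lam` this says that `y` is a proximal point of `y + lam • v`. -/
def IsProxPair (μ : ℝ) (φ : Rn n → EReal) (y v : Rn n) : Prop :=
  φ y < ⊤ ∧ ∀ x, φ y + ((inner ℝ v (x - y) - μ / 2 * ‖x - y‖ ^ 2 : ℝ) : EReal) ≤ φ x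

lemma IsProxPair.mono {μ ν : ℝ} {φ : Rn n → EReal} {y v : Rn n} (h : IsProxPair μ φ y v)
    (hμν : μ ≤ ν) : IsProxPair ν φ y v := by
  refine ⟨h.1, fun x => le_trans (add_le_add_right ?_ _) (h.2 x)⟩
  rw [EReal.coe_le_coe_iff]
  nlinarith [sq_nonneg ‖x - y‖]

lemma IsProxPair.mem_gphSubdiff {μ : ℝ} {φ : Rn n → EReal} {y v : Rn n}
    (h : IsProxPair μ φ y v) (hb : φ y ≠ ⊥) : (y, v) ∈ gphSubdiff φ :=
  regularSubdiff_subset_limitingSubdiff (mem_regularSubdiff_of_le hb h.1 (μ / 2) h.2)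

lemma ProxBounded.exists_minorant {φ : Rn n → EReal} (h : ProxBounded φ) :
    ∃ (c a : ℝ) (z : Rn n), 0 ≤ a ∧ ∀ x, ((c - a * ‖x - z‖ ^ 2 : ℝ) : EReal) ≤ φ x := by
  obtain ⟨lam, hlam, z, hz⟩ := h
  obtain ⟨c, -, hc⟩ := EReal.lt_iff_exists_real_btwn.1 hz
  refine ⟨c, 1 / (2 * lam), z, by positivity, fun x => ?_⟩
  have := hc.le.trans (iInf_le _ x)
  induction hx : φ x with
  | bot =>
    rw [hx, EReal.bot_add, le_bot_iff] at this
    exact absurd this (EReal.coe_ne_bot _)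
  | top => exact le_top
  | coe b =>
    rw [hx] at this
    norm_cast at this ⊢
    linarith

/-- For a prox-bounded function the local inequality of prox-regularity becomes global after
increasing the curvature. -/
lemma ProxRegular.exists_isProxPair {φ : Rn n → EReal} {xbar vbar : Rn n}
    (hproper : ∀ x, φ x ≠ ⊥) (hpb : ProxBounded φ) (hxbar : φ xbar < ⊤)
    (h : ProxRegular φ xbar vbar) :
    ∃ δ : ℝ, 0 < δ ∧ ∃ R : ℝ, 0 < R ∧ ∀ u v, (u, v) ∈ gphSubdiff φ → ‖u - xbar‖ ≤ δ →
      ‖v - vbar‖ ≤ δ → φ u < φ xbar + (δ : EReal) → IsProxPair R φ u v := by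
  obtain ⟨ε, hε, r, hr, H⟩ := h
  obtain ⟨c, a, z, ha, hminor⟩ := hpb.exists_minorant
  obtain ⟨f, hf⟩ := exists_real_of_ne_bot_of_lt_top (hproper xbar) hxbar
  set D := 1 + ‖xbar - z‖ with hD
  set M := ‖vbar‖ + 1 with hM
  set e := ε / 2 with he
  have he0 : 0 < e := by positivity
  have hD0 : 0 ≤ D := by positivity
  have hM0 : 0 < M := by positivity
  -- The three terms absorb, for `s = ‖x - u‖ ≥ e`, the gap in constants, the linear term and the
  -- quadratic minorant of `φ`, each by means of `1 ≤ s / e`.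
  set Q := |f + 1 - c| / e ^ 2 + M / e + a * (1 + D / e) ^ 2 with hQ
  have hQ0 : 0 < Q := by positivity
  -- The bound `e = ε / 2` keeps `u` at distance at least `e` from points outside the `ε`-ball; the
  -- bound `1` gives `φ u < f + 1` and `‖v‖ ≤ M`.
  refine ⟨min e 1, by positivity, r + 2 * Q, by positivity, fun u v huv hu hv hfu => ?_⟩
  have hue := hu.trans (min_le_left _ _)
  have hu1 := hu.trans (min_le_right _ _)
  have hve := hv.trans (min_le_left _ _)
  have hv1 := hv.trans (min_le_right _ _)
  have hut : φ u < ⊤ := huv.1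
  refine ⟨hut, fun x => ?_⟩
  obtain ⟨b, hb⟩ := exists_real_of_ne_bot_of_lt_top (hproper u) hut
  rw [hf, hb] at hfu
  norm_cast at hfu
  have hb1 : b < f + 1 := hfu.trans_le (add_le_add_right (min_le_right _ _) f)
  by_cases hx : ‖x - xbar‖ ≤ ε
  · refine le_trans (add_le_add_right ?_ _) (H x (by simpa [dist_eq_norm] using hx) u
      (by rw [mem_closedBall_iff_norm]; linarith) v (by rw [mem_closedBall_iff_norm]; linarith)
      huv ?_)
    · rw [EReal.coe_le_coe_iff]
      nlinarith [mul_nonneg hQ0.le (sq_nonneg ‖x - u‖)]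
    · rw [hf, hb]
      norm_cast
      linarith [min_le_left e 1]
  · push Not at hx
    refine le_trans ?_ (hminor x)
    rw [hb, ← EReal.coe_add, EReal.coe_le_coe_iff]
    set s := ‖x - u‖ with hs
    have hse : e ≤ s := by
      have := norm_sub_le_norm_sub_add_norm_sub x u xbar
      linarith
    have hxz : ‖x - z‖ ≤ s + D := by
      have h1 := norm_sub_le_norm_sub_add_norm_sub x u z
      have h2 := norm_sub_le_norm_sub_add_norm_sub u xbar z
      linarith
    have hvM : inner ℝ v (x - u) ≤ M * s := by
      refine (real_inner_le_norm _ _).trans (mul_le_mul_of_nonneg_right ?_ (norm_nonneg _))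
      have := norm_sub_norm_le v vbar
      linarith
    have hs0 : 0 < s := he0.trans_le hse
    have hes : 1 ≤ s / e := (one_le_div he0).2 hse
    have t1 : f + 1 - c ≤ |f + 1 - c| / e ^ 2 * s ^ 2 := by
      have : |f + 1 - c| / e ^ 2 * s ^ 2 = |f + 1 - c| * (s / e) ^ 2 := by field_simp
      rw [this]
      exact (le_abs_self _).trans (le_mul_of_one_le_right (abs_nonneg _) (one_le_pow₀ hes))
    have t2 : M * s ≤ M / e * s ^ 2 := by
      have : M / e * s ^ 2 = M * s * (s / e) := by field_simp
      rw [this]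
      exact le_mul_of_one_le_right (by positivity) hes
    have t3 : a * ‖x - z‖ ^ 2 ≤ a * (1 + D / e) ^ 2 * s ^ 2 := by
      rw [mul_assoc, ← mul_pow]
      refine mul_le_mul_of_nonneg_left (pow_le_pow_left₀ (norm_nonneg _) (hxz.trans ?_) 2) ha
      have : (1 + D / e) * s = s + D * (s / e) := by field_simp
      rw [this]
      exact add_le_add_right (le_mul_of_one_le_right hD0 hes) _
    have : (r + 2 * Q) / 2 * s ^ 2 = r / 2 * s ^ 2 + |f + 1 - c| / e ^ 2 * s ^ 2
        + M / e * s ^ 2 + a * (1 + D / e) ^ 2 * s ^ 2 := by rw [hQ]; ring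
    have : 0 ≤ r / 2 * s ^ 2 := by positivity
    linarith

/-! ### Localization and existence of proximal points -/

lemma norm_sub_le_of_mul_sq_le {lam μ R : ℝ} (hlam : lam * μ = 1) (hμ : 0 < μ)
    {d q w : Rn n} (hw : d + lam • q = w)
    (h : -inner ℝ q d ≤ (μ + R) / 2 * ‖d‖ ^ 2) :
    (μ - R) * ‖d‖ ≤ 2 * μ * ‖w‖ := by
  rcases (norm_nonneg d).eq_or_lt with h0 | h0
  · rw [← h0, mul_zero]; positivity
  have h1 : inner ℝ w d = ‖d‖ ^ 2 + lam * inner ℝ q d := by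
    rw [← hw, inner_add_left, real_inner_self_eq_norm_sq, real_inner_smul_left]
  have h2 := real_inner_le_norm w d
  refine le_of_mul_le_mul_right (a := ‖d‖) ?_ h0
  have h3 : μ * inner ℝ w d = μ * ‖d‖ ^ 2 + inner ℝ q d := by
    rw [h1]; linear_combination (inner ℝ q d) * hlam
  nlinarith [mul_le_mul_of_nonneg_left h2 hμ.le]

/-- Proximal points depend on the base point in a calm way at a pair with a better global
quadratic minorant. -/
lemma IsProxPair.mul_norm_sub_le {lam μ R : ℝ} (hlam : lam * μ = 1) (hμ : 0 < μ)
    {φ : Rn n → EReal} {xbar vbar y v : Rn n} (hproper : ∀ x, φ x ≠ ⊥)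
    (hbar : IsProxPair R φ xbar vbar) (hy : IsProxPair μ φ y v) :
    (μ - R) * ‖y - xbar‖ ≤ 2 * μ * ‖y + lam • v - (xbar + lam • vbar)‖ := by
  obtain ⟨f, hf⟩ := exists_real_of_ne_bot_of_lt_top (hproper _) hbar.1
  obtain ⟨b, hb⟩ := exists_real_of_ne_bot_of_lt_top (hproper _) hy.1
  have h1 := hbar.2 y
  have h2 := hy.2 xbar
  rw [hf, hb] at h1 h2
  norm_cast at h1 h2
  refine norm_sub_le_of_mul_sq_le hlam hμ (d := y - xbar) (q := v - vbar) (by module) ?_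
  rw [← neg_sub y xbar, norm_neg, inner_neg_right] at h2
  rw [inner_sub_left]
  linarith

/-- Proximal pairs are close to the reference pair, also in value, if their base points are. -/
lemma IsProxPair.exists_localization {lam μ R : ℝ} (hlam : lam * μ = 1) (hμ : 0 < μ)
    (hRμ : R < μ) {φ : Rn n → EReal} {xbar vbar : Rn n} (hproper : ∀ x, φ x ≠ ⊥)
    (hbar : IsProxPair R φ xbar vbar) {η : ℝ} (hη : 0 < η) :
    ∃ ρ : ℝ, 0 < ρ ∧ ∀ y v, IsProxPair μ φ y v →
      ‖y + lam • v - (xbar + lam • vbar)‖ < ρ →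
      ‖y - xbar‖ < η ∧ ‖v - vbar‖ < η ∧ φ y < φ xbar + (η : EReal) := by
  obtain ⟨f, hf⟩ := exists_real_of_ne_bot_of_lt_top (hproper _) hbar.1
  set K := 2 * μ / (μ - R) with hK
  have hK0 : 0 < K := div_pos (by positivity) (sub_pos.2 hRμ)
  have hbound : ∀ y v, IsProxPair μ φ y v →
      ‖y - xbar‖ ≤ K * ‖y + lam • v - (xbar + lam • vbar)‖ := fun y v hy => by
    rw [hK, div_mul_eq_mul_div, le_div_iff₀ (sub_pos.2 hRμ), mul_comm]
    exact hbar.mul_norm_sub_le hlam hμ hproper hy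
  -- The three expressions bound the deviations of `y`, of `v` and of the value; each is continuous
  -- in `ρ` and vanishes at `0`.
  have hev : ∀ᶠ ρ in 𝓝 (0 : ℝ), K * ρ < η ∧ μ * (ρ + K * ρ) < η ∧
      (‖vbar‖ + μ * (ρ + K * ρ)) * (K * ρ) + μ / 2 * (K * ρ) ^ 2 < η := by
    refine ((Continuous.tendsto' (by fun_prop) 0 0 (by simp)).eventually (gt_mem_nhds hη)).and
      (((Continuous.tendsto' (by fun_prop) 0 0 (by simp)).eventually (gt_mem_nhds hη)).and
      ((Continuous.tendsto' (by fun_prop) 0 0 (by simp)).eventually (gt_mem_nhds hη)))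
  obtain ⟨ρ, ⟨h1, h2, h3⟩, hρ⟩ := ((hev.filter_mono nhdsWithin_le_nhds).and
    (self_mem_nhdsWithin : Set.Ioi (0 : ℝ) ∈ 𝓝[>] 0)).exists
  have hρ : 0 < ρ := hρ
  refine ⟨ρ, hρ, fun y v hy hw => ?_⟩
  have hyx : ‖y - xbar‖ ≤ K * ρ :=
    (hbound y v hy).trans (mul_le_mul_of_nonneg_left hw.le hK0.le)
  have hvv : ‖v - vbar‖ ≤ μ * (ρ + K * ρ) := by
    have he : v - vbar = μ • ((y + lam • v - (xbar + lam • vbar)) - (y - xbar)) := by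
      have : (y + lam • v - (xbar + lam • vbar)) - (y - xbar) = lam • (v - vbar) := by module
      rw [this, smul_smul, mul_comm, hlam, one_smul]
    rw [he, norm_smul, Real.norm_eq_abs, abs_of_pos hμ]
    exact mul_le_mul_of_nonneg_left
      ((norm_sub_le _ _).trans (add_le_add hw.le hyx)) hμ.le
  refine ⟨hyx.trans_lt h1, hvv.trans_lt h2, ?_⟩
  obtain ⟨b, hb⟩ := exists_real_of_ne_bot_of_lt_top (hproper _) hy.1
  have h4 := hy.2 xbar
  rw [hf, hb] at h4 ⊢
  norm_cast at h4 ⊢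
  rw [← neg_sub y xbar, norm_neg, inner_neg_right] at h4
  have h5 : inner ℝ v (y - xbar) ≤ (‖vbar‖ + μ * (ρ + K * ρ)) * (K * ρ) := by
    refine (real_inner_le_norm _ _).trans
      (mul_le_mul ?_ hyx (norm_nonneg _) (by positivity))
    have := norm_sub_norm_le v vbar
    linarith
  have h6 : μ / 2 * ‖y - xbar‖ ^ 2 ≤ μ / 2 * (K * ρ) ^ 2 := by gcongr
  linarith

/-- Completing the square: the term `lam ^ 2 * ‖v‖ ^ 2` occurs on both sides and cancels. -/
lemma isProxPair_iff {lam μ : ℝ} (hlam : lam * μ = 1)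
    {φ : Rn n → EReal} {y v w : Rn n} (hw : y + lam • v = w) (hproper : ∀ x, φ x ≠ ⊥)
    (hy : φ y < ⊤) :
    IsProxPair μ φ y v ↔ ∀ x, φ y + ((μ / 2 * ‖y - w‖ ^ 2 : ℝ) : EReal) ≤
      φ x + ((μ / 2 * ‖x - w‖ ^ 2 : ℝ) : EReal) := by
  obtain ⟨b, hb⟩ := exists_real_of_ne_bot_of_lt_top (hproper _) hy
  rw [IsProxPair, and_iff_right hy]
  refine forall_congr' fun x => ?_
  rcases eq_or_ne (φ x) ⊤ with ht | ht
  · simp [ht, -EReal.coe_mul, -EReal.coe_pow]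
  obtain ⟨c, hc⟩ := exists_real_of_ne_bot_of_lt_top (hproper x) (lt_top_iff_ne_top.2 ht)
  rw [hb, hc]
  norm_cast
  have h1 : ‖x - w‖ ^ 2 = ‖x - y‖ ^ 2 - 2 * (lam * inner ℝ v (x - y)) + lam ^ 2 * ‖v‖ ^ 2 := by
    have : x - w = (x - y) - lam • v := by rw [← hw]; module
    rw [this, norm_sub_sq_real, real_inner_smul_right, real_inner_comm, norm_smul, mul_pow,
      Real.norm_eq_abs, sq_abs]
  have h2 : ‖y - w‖ ^ 2 = lam ^ 2 * ‖v‖ ^ 2 := by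
    have : y - w = -(lam • v) := by rw [← hw]; module
    rw [this, norm_neg, norm_smul, mul_pow, Real.norm_eq_abs, sq_abs]
  rw [h1, h2]
  have h3 : μ / 2 * (‖x - y‖ ^ 2 - 2 * (lam * inner ℝ v (x - y)) + lam ^ 2 * ‖v‖ ^ 2)
      = μ / 2 * ‖x - y‖ ^ 2 - inner ℝ v (x - y) + μ / 2 * (lam ^ 2 * ‖v‖ ^ 2) := by
    linear_combination -(inner ℝ v (x - y)) * hlam
  rw [h3]
  constructor <;> intro h <;> linarith

/-- Proximal points exist. -/
lemma IsProxPair.exists_of_lowerSemicontinuous {lam μ R : ℝ} (hlam : lam * μ = 1) (hμ : 0 < μ)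
    (hRμ : R < μ) {φ : Rn n → EReal} {xbar vbar : Rn n} (hproper : ∀ x, φ x ≠ ⊥)
    (hlsc : LowerSemicontinuous φ) (hbar : IsProxPair R φ xbar vbar) (w : Rn n) :
    ∃ y v, IsProxPair μ φ y v ∧ y + lam • v = w := by
  obtain ⟨f, hf⟩ := exists_real_of_ne_bot_of_lt_top (hproper _) hbar.1
  set g : Rn n → EReal := fun x => φ x + ((μ / 2 * ‖x - w‖ ^ 2 : ℝ) : EReal) with hg
  have hglsc : LowerSemicontinuous g := by
    refine hlsc.add' (continuous_coe_real_ereal.comp (by fun_prop)).lowerSemicontinuous fun x => ?_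
    exact EReal.continuousAt_add (Or.inr (EReal.coe_ne_bot _)) (Or.inr (EReal.coe_ne_top _))
  -- Any point with a smaller value of `g` than `xbar` lies in this ball, so minimizing over the
  -- compact ball minimizes globally.
  set r := 2 * μ * ‖w - (xbar + lam • vbar)‖ / (μ - R) with hr
  have hr0 : 0 ≤ r := div_nonneg (by positivity) (sub_pos.2 hRμ).le
  obtain ⟨y, hyB, hymin⟩ := (hglsc.lowerSemicontinuousOn _).exists_isMinOn
    (s := Metric.closedBall xbar r) ⟨xbar, Metric.mem_closedBall_self hr0⟩
    (isCompact_closedBall xbar r)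
  have hgx : g y ≤ g xbar := hymin (Metric.mem_closedBall_self hr0)
  have hglob : ∀ x, g y ≤ g x := by
    intro x
    by_cases hx : x ∈ Metric.closedBall xbar r
    · exact hymin hx
    refine hgx.trans ?_
    by_contra hlt
    push Not at hlt
    apply hx
    have hxt : φ x ≠ ⊤ := by
      intro ht
      simp only [hg, ht, EReal.top_add_coe] at hlt
      exact not_top_lt hlt
    obtain ⟨b, hb⟩ := exists_real_of_ne_bot_of_lt_top (hproper x) (lt_top_iff_ne_top.2 hxt)
    have h1 := hbar.2 x
    simp only [hg, hf, hb] at hlt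
    rw [hf, hb] at h1
    norm_cast at h1 hlt
    rw [mem_closedBall_iff_norm, hr, le_div_iff₀ (sub_pos.2 hRμ), mul_comm]
    -- `μ • (w - x)` is the slope for which `x` has base point `w`.
    refine norm_sub_le_of_mul_sq_le hlam hμ (d := x - xbar) (q := μ • (w - x) - vbar) ?_ ?_
    · rw [smul_sub, smul_smul, hlam, one_smul]; module
    have h2 : ‖xbar - w‖ ^ 2 = ‖x - xbar‖ ^ 2 + 2 * inner ℝ (w - x) (x - xbar)
        + ‖x - w‖ ^ 2 := by
      have : xbar - w = -((x - xbar) + (w - x)) := by module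
      rw [this, norm_neg, norm_add_sq_real, real_inner_comm, norm_sub_rev w x]
    rw [h2] at hlt
    rw [inner_sub_left, real_inner_smul_left]
    linarith
  have hyt : φ y < ⊤ := by
    rw [lt_top_iff_ne_top]
    intro ht
    simp only [hg, hf, ht] at hgx
    rw [EReal.top_add_coe, top_le_iff, ← EReal.coe_add] at hgx
    exact EReal.coe_ne_top _ hgx
  have hw : y + lam • (μ • (w - y)) = w := by
    rw [smul_smul, hlam, one_smul]; module
  exact ⟨y, μ • (w - y), (isProxPair_iff hlam hw hproper hyt).2 hglob, hw⟩

/-! ### The Moreau envelope at proximal pairs -/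

lemma moreauEnvelope_le {lam μ : ℝ} (hlam : lam * μ = 1) (φ : Rn n → EReal) (y w : Rn n) :
    moreauEnvelope lam φ w ≤ φ y + ((μ / 2 * ‖y - w‖ ^ 2 : ℝ) : EReal) := by
  have h : μ / 2 = 1 / (2 * lam) := by
    have : lam ≠ 0 := left_ne_zero_of_mul_eq_one hlam
    field_simp
    linarith
  rw [h]
  exact iInf_le _ y

lemma IsProxPair.moreauEnvelope_eq {lam μ : ℝ} (hlam : lam * μ = 1)
    {φ : Rn n → EReal} {y v w : Rn n} (hproper : ∀ x, φ x ≠ ⊥)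
    (hy : IsProxPair μ φ y v) (hw : y + lam • v = w) :
    moreauEnvelope lam φ w = φ y + ((μ / 2 * ‖y - w‖ ^ 2 : ℝ) : EReal) := by
  refine le_antisymm (moreauEnvelope_le hlam φ y w) (le_iInf fun x => ?_)
  have h : 1 / (2 * lam) = μ / 2 := by
    have : lam ≠ 0 := left_ne_zero_of_mul_eq_one hlam
    field_simp
    linarith
  rw [h]
  exact (isProxPair_iff hlam hw hproper hy.1).1 hy x

/-! ### From variational strong convexity to the envelope -/

lemma VariationallyStronglyConvexWith.exists_model {φ : Rn n → EReal} {xbar vbar : Rn n} {σ : ℝ}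
    (h : VariationallyStronglyConvexWith φ xbar vbar σ) :
    ∃ U ∈ 𝓝 xbar, ∃ ψ : Rn n → EReal, StronglyConvexOn U σ ψ ∧ (∀ x ∈ U, ψ x ≤ φ x) ∧
      ∃ δ : ℝ, 0 < δ ∧ ∀ u v, (u, v) ∈ gphSubdiff φ → ‖u - xbar‖ < δ → ‖v - vbar‖ < δ →
        φ u < φ xbar + (δ : EReal) → u ∈ U ∧ φ u = ψ u ∧
          ∀ x ∈ U, ψ u + ((inner ℝ v (x - u) + σ / 2 * ‖x - u‖ ^ 2 : ℝ) : EReal) ≤ ψ x := by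
  obtain ⟨U, hU, V, hV, -, -, ψ, hbot, -, hsc, hle, ε, hε, hgph, heq⟩ := h
  refine ⟨U, hU, ψ, hsc, hle, ?_⟩
  obtain ⟨δ₁, hδ₁, hU₁⟩ := Metric.mem_nhds_iff.1 (interior_mem_nhds.2 hU)
  obtain ⟨δ₂, hδ₂, hV₂⟩ := Metric.mem_nhds_iff.1 hV
  refine ⟨min ε (min δ₁ δ₂), by positivity, fun u v huv hu hv hφ => ?_⟩
  -- Interior membership is needed so that the regular subgradients approximating `v` are eventually
  -- taken at points of `U`.
  have huU : u ∈ interior U := hU₁ (mem_ball_iff_norm.2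
    (hu.trans_le ((min_le_right _ _).trans (min_le_left _ _))))
  have hvV : v ∈ V := hV₂ (mem_ball_iff_norm.2
    (hv.trans_le ((min_le_right _ _).trans (min_le_right _ _))))
  have hmem : (u, v) ∈ (U ×ˢ V) ∩ gphSubdiff ψ := by
    rw [← hgph]
    exact ⟨⟨⟨interior_subset huU, hφ.trans_le
      (add_le_add_right (EReal.coe_le_coe_iff.2 (min_le_left _ _)) _)⟩, hvV⟩, huv⟩
  exact ⟨interior_subset huU, heq _ hmem, fun x hx =>
    hsc.le_of_mem_limitingSubdiff hbot huU hx hmem.2⟩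

lemma VariationallyStronglyConvexWith.proxRegular {φ : Rn n → EReal} {xbar vbar : Rn n} {σ : ℝ}
    (hσ : 0 ≤ σ) (h : VariationallyStronglyConvexWith φ xbar vbar σ) :
    ProxRegular φ xbar vbar := by
  obtain ⟨U, hU, ψ, -, hle, δ, hδ, H⟩ := h.exists_model
  obtain ⟨δ₁, hδ₁, hU₁⟩ := Metric.mem_nhds_iff.1 hU
  have hlt : min δ δ₁ / 2 < min δ δ₁ := half_lt_self (by positivity)
  -- Curvature `0` suffices: the model inequality has the nonnegative term in `σ`. Halving passes
  -- from open to closed balls.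
  refine ⟨min δ δ₁ / 2, by positivity, 0, le_rfl, fun x hx u hu v hv huv hφ => ?_⟩
  rw [mem_closedBall_iff_norm] at hx hu hv
  obtain ⟨-, heq, hux⟩ := H u v huv (hu.trans_lt (hlt.trans_le (min_le_left _ _)))
    (hv.trans_lt (hlt.trans_le (min_le_left _ _)))
    (hφ.trans_le (add_le_add_right
      (EReal.coe_le_coe_iff.2 (hlt.le.trans (min_le_left _ _))) _))
  have hxU : x ∈ U := hU₁ (mem_ball_iff_norm.2 (hx.trans_lt (hlt.trans_le (min_le_right _ _))))
  refine le_trans ?_ ((hux x hxU).trans (hle x hxU))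
  rw [heq]
  refine add_le_add_right (EReal.coe_le_coe_iff.2 ?_) _
  have : 0 ≤ σ / 2 * ‖x - u‖ ^ 2 := by positivity
  linarith

lemma norm_convexCombo_sq (p q : Rn n) (t : ℝ) :
    ‖(1 - t) • p + t • q‖ ^ 2 =
      (1 - t) * ‖p‖ ^ 2 + t * ‖q‖ ^ 2 - t * (1 - t) * ‖p - q‖ ^ 2 := by
  rw [norm_add_sq_real, norm_sub_sq_real, norm_smul, norm_smul, mul_pow, mul_pow,
    Real.norm_eq_abs, Real.norm_eq_abs, sq_abs, sq_abs, real_inner_smul_left,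
    real_inner_smul_right]
  ring

/-- After multiplication by `σ + μ` the difference of the two sides is `‖σ • p + μ • q‖ ^ 2`. The
constant is the modulus of an infimal convolution. -/
lemma mul_norm_sub_sq_le {σ μ : ℝ} (h : 0 < σ + μ) (p q : Rn n) :
    σ * μ / (σ + μ) * ‖p - q‖ ^ 2 ≤ σ * ‖p‖ ^ 2 + μ * ‖q‖ ^ 2 := by
  rw [div_mul_eq_mul_div, div_le_iff₀ h]
  have h1 : 0 ≤ ‖σ • p + μ • q‖ ^ 2 := sq_nonneg _
  rw [norm_add_sq_real, norm_smul, norm_smul, mul_pow, mul_pow, Real.norm_eq_abs,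
    Real.norm_eq_abs, sq_abs, sq_abs, real_inner_smul_left, real_inner_smul_right] at h1
  rw [norm_sub_sq_real]
  linarith

/-- Variational strong convexity makes the Moreau envelope locally strongly convex. -/
lemma VariationallyStronglyConvexWith.locallyStronglyConvexAround_moreauEnvelope
    {φ : Rn n → EReal} {xbar vbar : Rn n} {σ lam μ R : ℝ} (hσ : 0 < σ)
    (h : VariationallyStronglyConvexWith φ xbar vbar σ) (hlam : lam * μ = 1) (hμ : 0 < μ)
    (hRμ : R < μ) (hproper : ∀ x, φ x ≠ ⊥) (hlsc : LowerSemicontinuous φ)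
    (hbar : IsProxPair R φ xbar vbar) :
    LocallyStronglyConvexAround (moreauEnvelope lam φ) (xbar + lam • vbar) := by
  obtain ⟨U, hU, ψ, hsc, hle, δ, hδ, H⟩ := h.exists_model
  obtain ⟨ρ, hρ, hloc⟩ := hbar.exists_localization hlam hμ hRμ hproper hδ
  have key : ∀ w ∈ Metric.ball (xbar + lam • vbar) ρ, ∃ (y v : Rn n) (b : ℝ),
      y + lam • v = w ∧ y ∈ U ∧ ψ y = b ∧
      moreauEnvelope lam φ w = ((b + μ / 2 * ‖y - w‖ ^ 2 : ℝ) : EReal) ∧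
      ∀ x ∈ U, ψ y + ((inner ℝ v (x - y) + σ / 2 * ‖x - y‖ ^ 2 : ℝ) : EReal) ≤ ψ x := by
    intro w hw
    obtain ⟨y, v, hyv, hyw⟩ :=
      hbar.exists_of_lowerSemicontinuous hlam hμ hRμ hproper hlsc w
    obtain ⟨b, hb⟩ := exists_real_of_ne_bot_of_lt_top (hproper y) hyv.1
    obtain ⟨h1, h2, h3⟩ := hloc y v hyv (by rwa [hyw, ← mem_ball_iff_norm])
    obtain ⟨hyU, heq, hsub⟩ := H y v (hyv.mem_gphSubdiff (hproper y)) h1 h2 h3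
    refine ⟨y, v, b, hyw, hyU, heq ▸ hb, ?_, hsub⟩
    rw [hyv.moreauEnvelope_eq hlam hproper hyw, hb, EReal.coe_add]
  refine ⟨_, Metric.ball_mem_nhds _ hρ, σ * μ / (σ + μ), by positivity, convex_ball _ _, ?_⟩
  intro w₁ hw₁ w₂ hw₂ t ht0 ht1
  obtain ⟨y₁, v₁, b₁, -, hy₁U, hb₁, he₁, -⟩ := key w₁ hw₁
  obtain ⟨y₂, v₂, b₂, -, hy₂U, hb₂, he₂, -⟩ := key w₂ hw₂
  have hwt := (convex_ball (xbar + lam • vbar) ρ) hw₁ hw₂ (sub_nonneg.2 ht1) ht0 (by ring)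
  obtain ⟨y, v, b, hyw, hyU, hb, he, hsub⟩ := key _ hwt
  set w := (1 - t) • w₁ + t • w₂ with hw
  set p := (1 - t) • y₁ + t • y₂ with hp
  have hpU : p ∈ U := hsc.1 hy₁U hy₂U (sub_nonneg.2 ht1) ht0 (by ring)
  have h1 := (hsub p hpU).trans (hsc.2 y₁ hy₁U y₂ hy₂U t ht0 ht1)
  rw [hb, hb₁, hb₂] at h1
  rw [he, he₁, he₂]
  norm_cast at h1 ⊢
  have h2 : 0 ≤ σ / 2 * ‖p - y‖ ^ 2 := by positivity
  -- The subgradient inequality at `y` is tested at the combination `p` of the two proximal points;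
  -- this is the joint convexity argument for infimal convolutions.
  have h3 : μ / 2 * ‖y - w‖ ^ 2 ≤ inner ℝ v (p - y) + μ / 2 * ‖p - w‖ ^ 2 := by
    have e1 : p - w = (p - y) - lam • v := by rw [← hyw]; module
    have e2 : y - w = -(lam • v) := by rw [← hyw]; module
    rw [e1, e2, norm_neg, norm_sub_sq_real, real_inner_smul_right, real_inner_comm v (p - y)]
    have : 0 ≤ μ / 2 * ‖p - y‖ ^ 2 := by positivity
    have : μ / 2 * (2 * (lam * inner ℝ v (p - y))) = inner ℝ v (p - y) := by
      linear_combination (inner ℝ v (p - y)) * hlam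
    linarith
  have h4 : ‖p - w‖ ^ 2 = (1 - t) * ‖y₁ - w₁‖ ^ 2 + t * ‖y₂ - w₂‖ ^ 2
      - t * (1 - t) * ‖(y₁ - w₁) - (y₂ - w₂)‖ ^ 2 := by
    rw [← norm_convexCombo_sq]
    congr 2
    module
  -- The strong convexity gains of `ψ` and of the squared distance combine into a gain in `‖w₁ - w₂‖
  -- ^ 2`.
  have h5 := mul_norm_sub_sq_le (add_pos hσ hμ) (y₁ - y₂) ((y₁ - w₁) - (y₂ - w₂))
  have e3 : (y₁ - y₂) - ((y₁ - w₁) - (y₂ - w₂)) = w₁ - w₂ := by module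
  rw [e3] at h5
  have h6 := mul_le_mul_of_nonneg_left h5 (mul_nonneg ht0 (sub_nonneg.2 ht1))
  rw [h4] at h3
  linarith

/-! ### From the envelope to subgradient inequalities -/

/-- A strongly convex function with a quadratic majorant at a point has quadratic growth there. -/
lemma le_of_stronglyConvex_of_quadratic_majorant {E : Rn n → ℝ} {S : Set (Rn n)} {κ C : ℝ}
    (hS : IsOpen S) (hκ : 0 ≤ κ)
    (hE : ∀ x ∈ S, ∀ y ∈ S, ∀ t : ℝ, 0 ≤ t → t ≤ 1 →
      E ((1 - t) • x + t • y) ≤ (1 - t) * E x + t * E y - κ / 2 * t * (1 - t) * ‖x - y‖ ^ 2)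
    {w g z : Rn n} (hw : w ∈ S) (hz : z ∈ S)
    (hmaj : ∀ d, E (w + d) ≤ E w + inner ℝ g d + C * ‖d‖ ^ 2) :
    E w + inner ℝ g (z - w) + κ / 2 * ‖z - w‖ ^ 2 ≤ E z := by
  refine le_of_forall_small_mul (K := (C + κ / 2) * ‖z - w‖ ^ 2) ?_
  set d := z - w with hd
  filter_upwards [(tendsto_add_smul_zero w d).eventually (hS.mem_nhds hw),
    (tendsto_add_smul_zero w (-d)).eventually (hS.mem_nhds hw), Ioo_mem_nhdsGT (zero_lt_one' ℝ)]
    with t h1 h2 ⟨ht0, ht1⟩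
  -- Midpoint convexity turns the majorant at `w - t • d` into a lower bound at `w + t • d`, up to
  -- order `t ^ 2`.
  have hm := hE _ h1 _ h2 (1 / 2) (by norm_num) (by norm_num)
  have e1 : (1 - 1 / 2 : ℝ) • (w + t • d) + (1 / 2 : ℝ) • (w + t • -d) = w := by module
  rw [e1] at hm
  have hn : 0 ≤ κ / 2 * (1 / 2) * (1 - 1 / 2) * ‖w + t • d - (w + t • -d)‖ ^ 2 := by
    have : (0 : ℝ) ≤ 1 - 1 / 2 := by norm_num
    positivity
  have hu := hmaj (t • -d)
  rw [inner_smul_right, inner_neg_right, norm_smul, norm_neg, mul_pow, Real.norm_eq_abs,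
    sq_abs] at hu
  have hc := hE w hw z hz t ht0.le ht1.le
  have e2 : (1 - t) • w + t • z = w + t • d := by rw [hd]; module
  rw [e2, norm_sub_rev w z, ← hd] at hc
  linarith

/-- Local strong convexity of the Moreau envelope gives strong subgradient inequalities for `φ`. -/
lemma IsProxPair.le_of_stronglyConvexOn_moreauEnvelope {φ : Rn n → EReal} {xbar vbar y v x : Rn n}
    {lam μ R κ : ℝ} {S : Set (Rn n)} (hlam : lam * μ = 1) (hμ : 0 < μ)
    (hRμ : R < μ) (hproper : ∀ x, φ x ≠ ⊥) (hlsc : LowerSemicontinuous φ)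
    (hbar : IsProxPair R φ xbar vbar) (hS : IsOpen S) (hκ : 0 ≤ κ)
    (hsc : StronglyConvexOn S κ (moreauEnvelope lam φ)) (hyv : IsProxPair μ φ y v)
    (hw : y + lam • v ∈ S) (hz : x + lam • v ∈ S) :
    φ y + ((inner ℝ v (x - y) + κ / 2 * ‖x - y‖ ^ 2 : ℝ) : EReal) ≤ φ x := by
  have hfin : ∀ w, ∃ e : ℝ, moreauEnvelope lam φ w = e := by
    intro w
    obtain ⟨p, q, hpq, hpw⟩ :=
      hbar.exists_of_lowerSemicontinuous hlam hμ hRμ hproper hlsc w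
    obtain ⟨b, hb⟩ := exists_real_of_ne_bot_of_lt_top (hproper p) hpq.1
    exact ⟨b + μ / 2 * ‖p - w‖ ^ 2, by
      rw [hpq.moreauEnvelope_eq hlam hproper hpw, hb, EReal.coe_add]⟩
  choose E hE using hfin
  obtain ⟨b, hb⟩ := exists_real_of_ne_bot_of_lt_top (hproper y) hyv.1
  rcases eq_or_ne (φ x) ⊤ with ht | ht
  · rw [ht]; exact le_top
  obtain ⟨c, hc⟩ := exists_real_of_ne_bot_of_lt_top (hproper x) (lt_top_iff_ne_top.2 ht)
  have hEw : E (y + lam • v) = b + μ / 2 * ‖lam • v‖ ^ 2 := by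
    have := hyv.moreauEnvelope_eq hlam hproper rfl
    rw [hE, hb, sub_add_cancel_left, norm_neg] at this
    exact_mod_cast this
  have hEz : E (x + lam • v) ≤ c + μ / 2 * ‖lam • v‖ ^ 2 := by
    have := moreauEnvelope_le hlam φ x (x + lam • v)
    rw [hE, hc, sub_add_cancel_left, norm_neg] at this
    exact_mod_cast this
  have hgrow := le_of_stronglyConvex_of_quadratic_majorant (E := E) (g := v) (C := μ / 2) hS hκ
    (fun p hp q hq t ht0 ht1 => by
      have := hsc.2 p hp q hq t ht0 ht1
      simp only [hE] at this
      exact_mod_cast this) hw hz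
    (fun d => by
      -- Keeping `y` as competitor while the base point moves gives the quadratic majorant of slope
      -- `v`.
      have h1 := moreauEnvelope_le hlam φ y (y + lam • v + d)
      have e1 : y - (y + lam • v + d) = -(d + lam • v) := by module
      rw [hE, hb, e1, norm_neg, norm_add_sq_real, real_inner_smul_right, real_inner_comm] at h1
      norm_cast at h1
      rw [hEw]
      have : μ / 2 * (2 * (lam * inner ℝ v d)) = inner ℝ v d := by
        linear_combination (inner ℝ v d) * hlam
      linarith)
  rw [hEw, add_sub_add_right_eq_sub] at hgrow
  rw [hb, hc]
  norm_cast
  linarith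

lemma StronglyConvexOn.subset {f : Rn n → EReal} {Ω Ω' : Set (Rn n)} {κ : ℝ}
    (h : StronglyConvexOn Ω κ f) (hs : Ω' ⊆ Ω) (hc : Convex ℝ Ω') : StronglyConvexOn Ω' κ f :=
  ⟨hc, fun x hx y hy => h.2 x (hs hx) y (hs hy)⟩

/-! ### The supremum model and the converse -/

/-- The supremum of the quadratics of curvature `κ` with value `a i` and slope `v i` at `y i`. -/
noncomputable def quadSup {ι : Type*} (κ : ℝ) (a : ι → ℝ) (y v : ι → Rn n) (x : Rn n) : EReal :=
  ⨆ i, ((a i + (inner ℝ (v i) (x - y i) + κ / 2 * ‖x - y i‖ ^ 2) : ℝ) : EReal)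

section quadSup

variable {ι : Type*} (κ : ℝ) (a : ι → ℝ) (y v : ι → Rn n)

lemma le_quadSup (i : ι) (x : Rn n) :
    ((a i : ℝ) : EReal) + ((inner ℝ (v i) (x - y i) + κ / 2 * ‖x - y i‖ ^ 2 : ℝ) : EReal)
      ≤ quadSup κ a y v x := by
  rw [← EReal.coe_add]
  exact le_iSup (fun i => ((a i + (inner ℝ (v i) (x - y i) + κ / 2 * ‖x - y i‖ ^ 2) : ℝ) :
    EReal)) i

lemma lowerSemicontinuous_quadSup : LowerSemicontinuous (quadSup κ a y v) :=
  lowerSemicontinuous_iSup fun i =>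
    (continuous_coe_real_ereal.comp (g := ((↑) : ℝ → EReal))
      (f := fun x => a i + (inner ℝ (v i) (x - y i) + κ / 2 * ‖x - y i‖ ^ 2))
      (by fun_prop)).lowerSemicontinuous

/-- Each quadratic satisfies the inequality with equality, and its values are at most those of the
supremum. -/
lemma stronglyConvexOn_quadSup : StronglyConvexOn Set.univ κ (quadSup κ a y v) := by
  refine ⟨convex_univ, fun p _ q _ t ht0 ht1 => iSup_le fun i => ?_⟩
  have hp := le_quadSup κ a y v i p
  have hq := le_quadSup κ a y v i q
  rw [← EReal.coe_add] at hp hq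
  refine le_trans ?_ (EReal.sub_le_sub (add_le_add
    (mul_le_mul_of_nonneg_left hp (EReal.coe_nonneg.2 (sub_nonneg.2 ht1)))
    (mul_le_mul_of_nonneg_left hq (EReal.coe_nonneg.2 ht0))) le_rfl)
  norm_cast
  have e : (1 - t) • p + t • q - y i = (1 - t) • (p - y i) + t • (q - y i) := by module
  rw [e, norm_convexCombo_sq, inner_add_right, inner_smul_right, inner_smul_right,
    sub_sub_sub_cancel_right]
  apply le_of_eq
  ring

end quadSup

/-- Local strong convexity of one Moreau envelope makes a prox-regular function variationally
strongly convex. -/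
lemma variationallyStronglyConvexWith_of_moreauEnvelope {φ : Rn n → EReal} {xbar vbar : Rn n}
    {lam μ R κ δ : ℝ} {W : Set (Rn n)} (hlam0 : 0 < lam) (hlam : lam * μ = 1)
    (hRμ : R < μ) (hproper : ∀ x, φ x ≠ ⊥) (hlsc : LowerSemicontinuous φ)
    (hbar : IsProxPair R φ xbar vbar) (hδ : 0 < δ)
    (hreg : ∀ u v, (u, v) ∈ gphSubdiff φ → ‖u - xbar‖ ≤ δ →
      ‖v - vbar‖ ≤ δ → φ u < φ xbar + (δ : EReal) → IsProxPair R φ u v)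
    (hW : W ∈ 𝓝 (xbar + lam • vbar)) (hκ : 0 < κ)
    (hsc : StronglyConvexOn W κ (moreauEnvelope lam φ)) :
    VariationallyStronglyConvexWith φ xbar vbar κ := by
  have hμ : 0 < μ := pos_of_mul_pos_right (hlam ▸ one_pos) hlam0.le
  set z := xbar + lam • vbar with hz
  obtain ⟨ρ, hρ, hρW⟩ := Metric.mem_nhds_iff.1 hW
  have hl1 : 0 < 1 + lam := by positivity
  -- Points and slopes within `η` of the reference have base points in the `ρ`-ball, where the
  -- envelope is strongly convex. The same relation links `r` to `ρ₁` below, while `ρ₁ ≤ ρ'`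
  -- confines the pairs of `S` to within `η`.
  set η := min δ (ρ / (1 + lam)) with hη
  have hη0 : 0 < η := by positivity
  have hηρ : η * (1 + lam) ≤ ρ := (le_div_iff₀ hl1).1 (min_le_right _ _)
  obtain ⟨ρ', hρ', hloc⟩ := hbar.exists_localization hlam hμ hRμ hproper hη0
  set ρ₁ := min ρ ρ' with hρ₁
  have hρ₁0 : 0 < ρ₁ := by positivity
  set r := min η (ρ₁ / (1 + lam)) with hr
  have hr0 : 0 < r := by positivity
  have hrρ : r * (1 + lam) ≤ ρ₁ := (le_div_iff₀ hl1).1 (min_le_right _ _)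
  have hbase : ∀ {s : ℝ} {x v : Rn n}, ‖x - xbar‖ < s → ‖v - vbar‖ < s →
      ‖x + lam • v - z‖ < s * (1 + lam) := by
    intro s x v hx hv
    have e : x + lam • v - z = (x - xbar) + lam • (v - vbar) := by rw [hz]; module
    rw [e]
    refine (norm_add_le _ _).trans_lt ?_
    rw [norm_smul, Real.norm_eq_abs, abs_of_pos hlam0]
    nlinarith
  let S : Set (Rn n × Rn n) := {p | IsProxPair μ φ p.1 p.2 ∧ ‖p.1 + lam • p.2 - z‖ < ρ₁}
  have hSloc : ∀ p ∈ S, ‖p.1 - xbar‖ < η ∧ ‖p.2 - vbar‖ < η ∧ φ p.1 < φ xbar + (η : EReal) :=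
    fun p hp => hloc _ _ hp.1 (hp.2.trans_le (min_le_right _ _))
  have hreal : ∀ p ∈ S, ((φ p.1).toReal : EReal) = φ p.1 := fun p hp =>
    EReal.coe_toReal hp.1.1.ne (hproper _)
  have hkey : ∀ p ∈ S, ∀ x, ‖x - xbar‖ < η →
      φ p.1 + ((inner ℝ p.2 (x - p.1) + κ / 2 * ‖x - p.1‖ ^ 2 : ℝ) : EReal) ≤ φ x := by
    intro p hp x hx
    obtain ⟨-, h2, -⟩ := hSloc p hp
    exact hbar.le_of_stronglyConvexOn_moreauEnvelope hlam hμ hRμ hproper hlsc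
      Metric.isOpen_ball hκ.le (hsc.subset hρW (convex_ball _ _)) hp.1
      (mem_ball_iff_norm.2 (hp.2.trans_le (min_le_left _ _)))
      (mem_ball_iff_norm.2 ((hbase hx h2).trans_le hηρ))
  let ψ : Rn n → EReal :=
    quadSup κ (fun p : S => (φ p.1.1).toReal) (fun p => p.1.1) (fun p => p.1.2)
  have hψge : ∀ p ∈ S, ∀ x,
      φ p.1 + ((inner ℝ p.2 (x - p.1) + κ / 2 * ‖x - p.1‖ ^ 2 : ℝ) : EReal) ≤ ψ x := by
    intro p hp x
    have := le_quadSup κ (fun p : S => (φ p.1.1).toReal) (fun p => p.1.1) (fun p => p.1.2)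
      ⟨p, hp⟩ x
    rwa [hreal p hp] at this
  have hψle : ∀ x, ‖x - xbar‖ < η → ψ x ≤ φ x := by
    intro x hx
    refine iSup_le fun p => ?_
    rw [EReal.coe_add, hreal p.1 p.2]
    exact hkey p.1 p.2 x hx
  have hψeq : ∀ p ∈ S, ψ p.1 = φ p.1 := by
    intro p hp
    refine le_antisymm (hψle _ (hSloc p hp).1) ?_
    simpa using hψge p hp p.1
  have hbarS : (xbar, vbar) ∈ S := ⟨hbar.mono hRμ.le, by simpa [hz] using hρ₁0⟩
  have hψbot : ∀ x, ψ x ≠ ⊥ := by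
    intro x hx
    have := hψge _ hbarS x
    rw [hx, le_bot_iff, ← hreal _ hbarS, ← EReal.coe_add] at this
    exact EReal.coe_ne_bot _ this
  have hψS : ∀ x v, ‖x - xbar‖ < r → ‖v - vbar‖ < r → (x, v) ∈ gphSubdiff ψ → (x, v) ∈ S := by
    intro x v hx hv hxv
    have hw := (hbase hx hv).trans_le hrρ
    -- This pair shares its base point with `(x, v)`, so `v - q = μ • (y - x)`. Adding the two
    -- strong subgradient inequalities of `ψ` then forces `y = x`, hence `q = v`.
    obtain ⟨y, q, hyq, hyw⟩ :=
      hbar.exists_of_lowerSemicontinuous hlam hμ hRμ hproper hlsc (x + lam • v)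
    have hyS : (y, q) ∈ S := ⟨hyq, by simpa only [hyw] using hw⟩
    have h1 := (stronglyConvexOn_quadSup κ (fun p : S => (φ p.1.1).toReal) (fun p => p.1.1)
      (fun p => p.1.2)).le_of_mem_limitingSubdiff hψbot (by simp) (Set.mem_univ y) hxv
    change ψ x + _ ≤ ψ y at h1
    have h2 := hψge _ hyS x
    obtain ⟨c, hc⟩ := exists_real_of_ne_bot_of_lt_top (hψbot x) hxv.1
    rw [hψeq _ hyS, ← hreal _ hyS, hc] at h1
    rw [← hreal _ hyS, hc] at h2
    norm_cast at h1 h2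
    have e1 : v - q = μ • (y - x) := by
      have : y - x = lam • (v - q) := by
        rw [smul_sub, sub_eq_sub_iff_add_eq_add, hyw, add_comm]
      rw [this, smul_smul, mul_comm, hlam, one_smul]
    have e2 : inner ℝ v (y - x) - inner ℝ q (y - x) = μ * ‖y - x‖ ^ 2 := by
      rw [← inner_sub_left, e1, real_inner_smul_left, real_inner_self_eq_norm_sq]
    rw [← neg_sub y x, norm_neg, inner_neg_right] at h2
    have h3 : (μ + κ) * ‖y - x‖ ^ 2 ≤ 0 := by linarith
    have h4 : y - x = 0 := by
      have : ‖y - x‖ ^ 2 ≤ 0 := nonpos_of_mul_nonpos_right h3 (by positivity)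
      exact norm_eq_zero.1 (pow_eq_zero_iff two_ne_zero |>.1 (le_antisymm this (sq_nonneg _)))
    rw [h4, smul_zero, sub_eq_zero] at e1
    rw [sub_eq_zero] at h4
    rwa [e1, ← h4]
  refine ⟨Metric.ball xbar r, Metric.ball_mem_nhds _ hr0, Metric.ball vbar r,
    Metric.ball_mem_nhds _ hr0, convex_ball _ _, convex_ball _ _, ψ, hψbot,
    lowerSemicontinuous_quadSup _ _ _ _,
    (stronglyConvexOn_quadSup _ _ _ _).subset (Set.subset_univ _) (convex_ball _ _),
    fun x hx => hψle x ((mem_ball_iff_norm.1 hx).trans_le (min_le_left _ _)), η, hη0, ?_, ?_⟩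
  · ext ⟨x, v⟩
    constructor
    · rintro ⟨⟨⟨hx, hφx⟩, hv⟩, hxv⟩
      refine ⟨⟨hx, hv⟩, ?_⟩
      have hx' := mem_ball_iff_norm.1 hx
      have hv' := mem_ball_iff_norm.1 hv
      have hS : (x, v) ∈ S := ⟨(hreg x v hxv
        (hx'.le.trans ((min_le_left _ _).trans (min_le_left _ _)))
        (hv'.le.trans ((min_le_left _ _).trans (min_le_left _ _)))
        (hφx.trans_le (add_le_add_right (EReal.coe_le_coe_iff.2 (min_le_left _ _)) _))).mono
        hRμ.le, (hbase hx' hv').trans_le hrρ⟩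
      -- The constant is negative because the minorant of `ψ` curves upwards.
      refine regularSubdiff_subset_limitingSubdiff (mem_regularSubdiff_of_le (hψbot x) ?_
        (-(κ / 2)) fun y => ?_)
      · exact (hψeq _ hS).trans_lt hxv.1
      · have := hψge _ hS y
        rw [← hψeq _ hS] at this
        convert this using 3
        ring
    · rintro ⟨⟨hx, hv⟩, hxv⟩
      have hS := hψS x v (mem_ball_iff_norm.1 hx) (mem_ball_iff_norm.1 hv) hxv
      -- The bound on `φ x` comes from the localization of proximal pairs.
      exact ⟨⟨⟨hx, (hSloc _ hS).2.2⟩, hv⟩, hS.1.mem_gphSubdiff (hproper x)⟩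
  · rintro ⟨x, v⟩ ⟨⟨hx, hv⟩, hxv⟩
    exact (hψeq _ (hψS x v (mem_ball_iff_norm.1 hx) (mem_ball_iff_norm.1 hv) hxv)).symm

end VarConv

theorem theorem4p5 (n : ℕ) (φ : VarConv.Rn n → EReal)
    (hproper : ∀ x, φ x ≠ ⊥) (hlsc : LowerSemicontinuous φ) (hpb : VarConv.ProxBounded φ)
    (xbar vbar : VarConv.Rn n) (hxbar : φ xbar < ⊤)
    (hvbar : vbar ∈ VarConv.limitingSubdiff φ xbar) :
    VarConv.VariationallyStronglyConvex φ xbar vbar ↔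
      VarConv.ProxRegular φ xbar vbar ∧
        ∃ lam0 : ℝ, 0 < lam0 ∧ ∀ lam : ℝ, 0 < lam → lam < lam0 →
          VarConv.LocallyStronglyConvexAround (VarConv.moreauEnvelope lam φ)
            (xbar + lam • vbar) := by
  have hbar : ∀ {δ R : ℝ}, 0 < δ → (∀ u v, (u, v) ∈ VarConv.gphSubdiff φ → ‖u - xbar‖ ≤ δ →
      ‖v - vbar‖ ≤ δ → φ u < φ xbar + (δ : EReal) → VarConv.IsProxPair R φ u v) →
      VarConv.IsProxPair R φ xbar vbar := by
    intro δ R hδ h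
    refine h _ _ hvbar (by simpa using hδ.le) (by simpa using hδ.le) ?_
    obtain ⟨a, ha⟩ := VarConv.exists_real_of_ne_bot_of_lt_top (hproper xbar) hxbar
    rw [ha]
    exact_mod_cast lt_add_of_pos_right a hδ
  constructor
  · rintro ⟨σ, hσ, h⟩
    have hpr := h.proxRegular hσ.le
    obtain ⟨δ, hδ, R, hR, hreg⟩ := hpr.exists_isProxPair hproper hpb hxbar
    -- The threshold `R⁻¹` is exactly the condition `R < lam⁻¹ = μ`.
    refine ⟨hpr, R⁻¹, inv_pos.2 hR, fun lam hlam hlt => ?_⟩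
    exact h.locallyStronglyConvexAround_moreauEnvelope hσ (mul_inv_cancel₀ hlam.ne')
      (inv_pos.2 hlam) ((lt_inv_comm₀ hlam hR).1 hlt) hproper hlsc (hbar hδ hreg)
  · rintro ⟨hpr, lam0, hlam0, h⟩
    obtain ⟨δ, hδ, R, hR, hreg⟩ := hpr.exists_isProxPair hproper hpb hxbar
    obtain ⟨lam, hlam, hlt⟩ : ∃ lam : ℝ, 0 < lam ∧ lam < min lam0 R⁻¹ :=
      exists_between (lt_min hlam0 (inv_pos.2 hR))
    obtain ⟨W, hW, κ, hκ, hsc⟩ := h lam hlam (hlt.trans_le (min_le_left _ _))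
    exact ⟨κ, hκ, VarConv.variationallyStronglyConvexWith_of_moreauEnvelope hlam
      (mul_inv_cancel₀ hlam.ne') ((lt_inv_comm₀ hlam hR).1 (hlt.trans_le (min_le_right _ _)))
      hproper hlsc (hbar hδ hreg) hδ hreg hW hκ hsc⟩
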